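/- Let $(\mathbb F_n)_{n\ge 1}$ be any family of finite fields, of arbitrary characteristics, whose orders are bounded by a polynomial in $n$ (for instance a single finite field $\mathbb F_n=\mathbb F$). An algebraic algorithm of rank $t$ for $m\times m$ matrix multiplication over a field $\mathbb F$ consists of coefficients $\alpha_{kl\mu},\beta_{kl\mu},\lambda_{ij\mu}\in\mathbb F$ ($i,j,k,l\in\{1,\dots,m\}$, $\mu\in\{1,\dots,t\}$) such that for all $A,B\in\mathbb F^{m\times m}$ and all $i,j$ $$(AB)[i,j]=\sum_{\mu=1}^t\lambda_{ij\mu}\Big(\sum_{k,l}\alpha_{kl\mu}A[k,l]\Big)\Big(\sum_{k,l}\beta_{kl\mu}B[l,k]\Big).$$ Let $\omega$ denote the exponent of matrix multiplication over the family, i.e. the least real $\tau$ such that for every $\epsilon>0$ the product of two $m\times m$ matrices over $\mathbb F_n$ can be computed by an algebraic algorithm of rank $O(m^{\tau+\epsilon})$, with a constant independent of $n$ and $m$. (For a single field this is the usual exponent of matrix multiplication over that field.) In the congested clique model, $n$ nodes proceed in synchronous rounds; in each round every node sends to every node a message of $\beta\lceil\log_2(n+1)\rceil$ bits, possibly different for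 different receivers, where $\beta\ge1$ is a fixed integer. Local computation is unrestricted. Consider the inversion problem: for an invertible lower triangular matrix $A\in\mathbb F_n^{n\times n}$, each node $\ell\in\{1,\dots,n\}$ initially knows the row $A[\ell,*]$ and the column $A[*,\ell]$, and at the end must output the row $A^{-1}[\ell,*]$ and the column $A^{-1}[*,\ell]$. Then the deterministic round complexity of this problem is $O(n^{1-2/\omega})$, with the usual convention that an $o(1)$ in the exponent is ignored: for every $\epsilon>0$ there is a constant $C$ such that for every $n\ge1$ some deterministic protocol solves the problem for all invertible lower triangular $A\in\mathbb F_n^{n\times n}$ in at most $C\,n^{1-2/\omega+\epsilon}$ rounds. Moreover, for every real $\tau>2$ such that $m\times m$ matrices over $\mathbb F_n$ can be multiplied by algebraic algorithms of rank $O(m^{\tau})$ (with a constant independent of $n$ and $m$), the problem is solved deterministically in at most $C\,n^{1-2/\tau}$ rounds for all $n\ge1$, for some constant $C$ independent of $n$. -/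

import Mathlib

/-- There is an algebraic (bilinear) algorithm of rank `t` over `F` for the product of an `n × m`
matrix by an `m × n` matrix. -/
def HasAlgebraicMMAlgorithm (F : Type*) [Field F] (n m t : ℕ) : Prop :=
  ∃ (α β : Fin n → Fin m → Fin t → F) (lam : Fin n → Fin n → Fin t → F),
    ∀ (A : Matrix (Fin n) (Fin m) F) (B : Matrix (Fin m) (Fin n) F) (i j : Fin n),
      (A * B) i j = ∑ μ : Fin t, lam i j μ *
        (∑ k : Fin n, ∑ l : Fin m, α k l μ * A k l) *
        (∑ k : Fin n, ∑ l : Fin m, β k l μ * B l k)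

/-- Square matrices over the fields of the family `F` can be multiplied by algebraic algorithms of
rank `O(m ^ τ)`, where `m` is the size of the matrices. The constant does not depend on the member
of the family. For a constant family this is the usual notion over one field. -/
def SquareMMRankBigO (F : ℕ → Type*) [∀ n, Field (F n)] (τ : ℝ) : Prop :=
  ∃ K : ℝ, ∀ n : ℕ, 1 ≤ n → ∀ m : ℕ, 1 ≤ m →
    ∃ t : ℕ, (t : ℝ) ≤ K * (m : ℝ) ^ τ ∧ HasAlgebraicMMAlgorithm (F n) m m t

/-- The exponent `ω` of square matrix multiplication over the family `F`: the least `τ` such that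
`m × m` matrices can be multiplied with rank `O(m ^ (τ + ε))` for every `ε > 0`. -/
noncomputable def matMulExponent (F : ℕ → Type*) [∀ n, Field (F n)] : ℝ :=
  sInf {τ : ℝ | ∀ ε : ℝ, 0 < ε → SquareMMRankBigO F (τ + ε)}

/-- A deterministic protocol for `n` nodes that communicate over a clique in synchronous rounds.
In each round every node sends to every node a message of `b` bits, which may be different for
different receivers. Local memory and local computation are unrestricted. -/
structure CliqueProtocol.{u} (n b : ℕ) (In Out : Type u) where
  /-- local states -/
  State : Type u
  /-- the initial state of a node, computed from its own input -/
  init : Fin n → In → State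
  /-- `send v s w` is the message sent to `w` by the node `v` in state `s` -/
  send : Fin n → State → Fin n → (Fin b → Bool)
  /-- `recv v s msg` is the new state of the node `v` in state `s` after it has received the
  message `msg u` from each node `u` -/
  recv : Fin n → State → (Fin n → (Fin b → Bool)) → State
  /-- the output of a node, computed from its own state -/
  out : Fin n → State → Out

namespace CliqueProtocol

universe u

variable {n b : ℕ} {In Out : Type u}

/-- The states of the nodes after a number of rounds, when the node `v` has the input `x v`. -/
def stateAfter (P : CliqueProtocol n b In Out) (x : Fin n → In) : ℕ → Fin n → P.State
  | 0, v => P.init v (x v)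
  | r + 1, v => P.recv v (P.stateAfter x r v) (fun w => P.send w (P.stateAfter x r w) v)

/-- The output of each node after `r` rounds. -/
def outputAfter (P : CliqueProtocol n b In Out) (x : Fin n → In) (r : ℕ) (v : Fin n) : Out :=
  P.out v (P.stateAfter x r v)

end CliqueProtocol

/-- The number of bits of a message in the congested clique with `n` nodes: `β ⌈log₂ (n + 1)⌉`. -/
def messageBits (β n : ℕ) : ℕ := β * Nat.clog 2 (n + 1)

/-- The part of a distributed `n × n` matrix that belongs to the node `ℓ`:
its `ℓ`-th row and its `ℓ`-th column. -/
def nodeShare {F : Type*} {n : ℕ} (A : Matrix (Fin n) (Fin n) F) (ℓ : Fin n) :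
    (Fin n → F) × (Fin n → F) :=
  (fun j => A ℓ j, fun i => A i ℓ)

/-- The inversion problem over `F`, for the invertible `n × n` matrices in `D`, can be solved
deterministically in `r` rounds of the congested clique with `n` nodes: initially the node `ℓ` has
the `ℓ`-th row and column of `A`, at the end it has the `ℓ`-th row and column of `A⁻¹`. -/
def InversionSolvableInRounds {F : Type*} [Field F] (β n : ℕ)
    (D : Set (Matrix (Fin n) (Fin n) F)) (r : ℕ) : Prop :=
  ∃ P : CliqueProtocol n (messageBits β n)
      ((Fin n → F) × (Fin n → F)) ((Fin n → F) × (Fin n → F)),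
    ∀ A ∈ D, IsUnit A → ∀ ℓ : Fin n, P.outputAfter (nodeShare A) r ℓ = nodeShare A⁻¹ ℓ

/-- The lower triangular `n × n` matrices. -/
def lowerTriangularMatrices (F : Type*) [Field F] (n : ℕ) : Set (Matrix (Fin n) (Fin n) F) :=
  {A | ∀ i j : Fin n, i < j → A i j = 0}

/-!
The knowledge of a node is the set of pairs of global inputs that it cannot distinguish. A scheme in
which every node sends and receives at most `k * n` field elements takes `O(k)` rounds: a greedy
edge colouring, whose colours are pairs of an intermediate node and a time slot, routes them without
conflicts.

Matrices with diagonal blocks of size `M ≤ 2 * n` are multiplied in `O(M ^ (1 - 2 / τ))` rounds, by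
a bilinear algorithm for `d × d` matrices of `e × e` blocks with `d ≈ M ^ (1 / τ)` and `e ≈ M / d`.
Its rank is then `O(M)`, so that there are `O(n)` products of `e × e` matrices in total.

The diagonal blocks of the inverse of a lower triangular matrix are found for sizes that double in
every step: `(D + L)⁻¹ = D⁻¹ - D⁻¹ * L * D⁻¹`, where `D` consists of the diagonal blocks and `L` of
the blocks below them in each pair, because `L * D⁻¹ * L = 0`. The costs of the steps form a
geometric sum, as `1 - 2 / τ > 0`.
-/

open scoped Finset
open OrderDual (toDual toDual_lt_toDual)

section BlockDiagonal

variable {ι κ R : Type*}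

/-- The matrix `M` is block diagonal, where the rows and columns of index `i` belong to the block
`c i`. -/
def IsBlockDiagonal [Zero R] (c : ι → κ) (M : Matrix ι ι R) : Prop :=
  ∀ i j, c i ≠ c j → M i j = 0

/-- The matrix that keeps the diagonal blocks of `M` and is zero elsewhere, where the rows and
columns of index `i` belong to the block `c i`. -/
def blockDiagonalPart [Zero R] [DecidableEq κ] (c : ι → κ) (M : Matrix ι ι R) : Matrix ι ι R :=
  Matrix.of fun i j => if c i = c j then M i j else 0

lemma IsBlockDiagonal.mul [Fintype ι] [NonUnitalNonAssocSemiring R] {c : ι → κ}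
    {M N : Matrix ι ι R} (hM : IsBlockDiagonal c M) (hN : IsBlockDiagonal c N) :
    IsBlockDiagonal c (M * N) := by
  intro i j hij
  rw [Matrix.mul_apply]
  refine Finset.sum_eq_zero fun p _ => ?_
  by_cases hip : c i = c p
  · rw [hN p j (hip ▸ hij), mul_zero]
  · rw [hM i p hip, zero_mul]

lemma IsBlockDiagonal.sub [AddGroup R] {c : ι → κ} {M N : Matrix ι ι R}
    (hM : IsBlockDiagonal c M) (hN : IsBlockDiagonal c N) : IsBlockDiagonal c (M - N) :=
  fun i j hij => by rw [Matrix.sub_apply, hM i j hij, hN i j hij, sub_zero]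

lemma IsBlockDiagonal.comp [Zero R] {κ' : Type*} {c : ι → κ} {M : Matrix ι ι R}
    (hM : IsBlockDiagonal c M) (f : κ → κ') : IsBlockDiagonal (f ∘ c) M :=
  fun i j hij => hM i j fun h => hij (congrArg f h)

lemma isBlockDiagonal_blockDiagonalPart [Zero R] [DecidableEq κ] (c : ι → κ) (M : Matrix ι ι R) :
    IsBlockDiagonal c (blockDiagonalPart c M) :=
  fun _ _ hij => if_neg hij

lemma blockDiagonalPart_of_forall_eq [Zero R] [DecidableEq κ] {c : ι → κ}
    (hc : ∀ i j, c i = c j) (M : Matrix ι ι R) : blockDiagonalPart c M = M := by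
  ext i j
  exact if_pos (hc i j)

lemma blockDiagonalPart_of_injective [Zero R] [DecidableEq κ] [DecidableEq ι] {c : ι → κ}
    (hc : Function.Injective c) (M : Matrix ι ι R) :
    blockDiagonalPart c M = Matrix.diagonal M.diag := by
  ext i j
  simp only [blockDiagonalPart, Matrix.of_apply, hc.eq_iff, Matrix.diagonal_apply,
    Matrix.diag_apply]
  split_ifs with h
  · rw [h]
  · rfl

lemma blockDiagonalPart_one [Zero R] [One R] [DecidableEq κ] [DecidableEq ι] (c : ι → κ) :
    blockDiagonalPart c (1 : Matrix ι ι R) = 1 := by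
  ext i j
  rcases eq_or_ne i j with rfl | hij
  · exact if_pos rfl
  · simp [blockDiagonalPart, hij]

end BlockDiagonal

section BlockTriangular

variable {ι α R : Type*} [Fintype ι] [LinearOrder α]

lemma blockDiagonalPart_mul_of_blockTriangular [NonUnitalNonAssocSemiring R] {c : ι → α}
    {A B : Matrix ι ι R} (hA : A.BlockTriangular (toDual ∘ c))
    (hB : B.BlockTriangular (toDual ∘ c)) :
    blockDiagonalPart c (A * B) = blockDiagonalPart c A * blockDiagonalPart c B := by
  ext i j
  by_cases hij : c i = c j
  · refine (if_pos hij).trans (Finset.sum_congr rfl fun p _ => ?_)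
    simp only [blockDiagonalPart, Matrix.of_apply]
    rcases lt_trichotomy (c i) (c p) with hp | hp | hp
    · rw [hA (toDual_lt_toDual.2 hp), ite_self, zero_mul, zero_mul]
    · rw [if_pos hp, if_pos (hp.symm.trans hij)]
    · rw [hB (toDual_lt_toDual.2 (hij ▸ hp)), ite_self, mul_zero, mul_zero]
  · rw [isBlockDiagonal_blockDiagonalPart c _ i j hij, ((isBlockDiagonal_blockDiagonalPart c A).mul
      (isBlockDiagonal_blockDiagonalPart c B)) i j hij]

variable [DecidableEq ι] [CommRing R] {A : Matrix ι ι R}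

lemma blockDiagonalPart_mul_blockDiagonalPart_inv {c : ι → α}
    (hA : A.BlockTriangular (toDual ∘ c)) (hu : IsUnit A) :
    blockDiagonalPart c A * blockDiagonalPart c A⁻¹ = 1 := by
  have := hu.invertible
  rw [← blockDiagonalPart_mul_of_blockTriangular hA
    (Matrix.blockTriangular_inv_of_blockTriangular hA), Matrix.mul_inv_of_invertible,
    blockDiagonalPart_one]

lemma apply_mul_inv_apply_self {c : ι → α} (hc : Function.Injective c)
    (hA : A.BlockTriangular (toDual ∘ c)) (hu : IsUnit A) (i : ι) : A i i * A⁻¹ i i = 1 := by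
  have h := blockDiagonalPart_mul_blockDiagonalPart_inv hA hu
  rw [blockDiagonalPart_of_injective hc, blockDiagonalPart_of_injective hc,
    Matrix.diagonal_mul_diagonal] at h
  simpa using congrFun (congrFun h i) i

end BlockTriangular

section PairOfBlocks

variable {ι R : Type*} {c : ι → ℕ}

/-- The part of `A` in the blocks of index `(x, y)` for which `x ≠ y` and `x / 2 = y / 2`, that is,
which join the two members of a pair of consecutive blocks. -/
def pairOffDiagonalPart [AddGroup R] (c : ι → ℕ) (A : Matrix ι ι R) : Matrix ι ι R :=
  blockDiagonalPart ((· / 2) ∘ c) A - blockDiagonalPart c A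

lemma isBlockDiagonal_pairOffDiagonalPart [AddGroup R] (c : ι → ℕ) (A : Matrix ι ι R) :
    IsBlockDiagonal ((· / 2) ∘ c) (pairOffDiagonalPart c A) :=
  (isBlockDiagonal_blockDiagonalPart _ A).sub ((isBlockDiagonal_blockDiagonalPart c A).comp _)

lemma pairOffDiagonalPart_apply_eq_zero [AddGroup R] {A : Matrix ι ι R}
    (hA : A.BlockTriangular (toDual ∘ c)) {i j : ι} (hij : Even (c i) ∨ Odd (c j)) :
    pairOffDiagonalPart c A i j = 0 := by
  simp only [pairOffDiagonalPart, blockDiagonalPart, Matrix.sub_apply, Matrix.of_apply,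
    Function.comp_apply]
  rcases lt_trichotomy (c i) (c j) with h | h | h
  · simp [hA (toDual_lt_toDual.2 h)]
  · simp [h]
  · have hne : c i / 2 ≠ c j / 2 := by grind
    rw [if_neg hne, if_neg h.ne', sub_zero]

variable [Fintype ι] [CommRing R] {A : Matrix ι ι R}

lemma pairOffDiagonalPart_mul_mul_self {B : Matrix ι ι R}
    (hA : A.BlockTriangular (toDual ∘ c)) (hB : IsBlockDiagonal c B) :
    pairOffDiagonalPart c A * B * pairOffDiagonalPart c A = 0 := by
  ext i j
  rw [Matrix.mul_apply, Matrix.zero_apply]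
  refine Finset.sum_eq_zero fun q _ => ?_
  rcases (c q).even_or_odd with hq | hq
  · rw [pairOffDiagonalPart_apply_eq_zero hA (.inl hq), mul_zero]
  · rw [Matrix.mul_apply, Finset.sum_eq_zero fun p _ => ?_, zero_mul]
    by_cases hpq : c p = c q
    · rw [pairOffDiagonalPart_apply_eq_zero hA (.inr (hpq ▸ hq)), zero_mul]
    · rw [hB p q hpq, mul_zero]

/-- With `D` the diagonal part of a pair of blocks and `L` the part below it, `L * D⁻¹ * L = 0`, so
that the Neumann series of `(D + L)⁻¹` ends after the linear term. -/
lemma blockDiagonalPart_div_two_inv [DecidableEq ι]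
    (hA : A.BlockTriangular (toDual ∘ c)) (hu : IsUnit A) :
    blockDiagonalPart ((· / 2) ∘ c) A⁻¹ = blockDiagonalPart c A⁻¹ -
      blockDiagonalPart c A⁻¹ * pairOffDiagonalPart c A * blockDiagonalPart c A⁻¹ := by
  set D := blockDiagonalPart c A
  set B := blockDiagonalPart c A⁻¹
  set L := pairOffDiagonalPart c A
  have hA₂ : A.BlockTriangular (toDual ∘ (· / 2) ∘ c) := fun i j hij =>
    hA (toDual_lt_toDual.2
      (Nat.lt_of_div_lt_div (toDual_lt_toDual.1 hij)))
  have hDB : D * B = 1 := blockDiagonalPart_mul_blockDiagonalPart_inv hA hu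
  have hLBL : L * B * L = 0 :=
    pairOffDiagonalPart_mul_mul_self hA (isBlockDiagonal_blockDiagonalPart c A⁻¹)
  have hDL : blockDiagonalPart ((· / 2) ∘ c) A = D + L := (add_sub_cancel _ _).symm
  have hright : (D + L) * (B - B * L * B) = 1 := by
    calc (D + L) * (B - B * L * B) = D * B + L * B - D * B * L * B - L * B * L * B := by
          noncomm_ring
      _ = 1 := by rw [hDB, hLBL, one_mul, zero_mul, sub_zero, add_sub_cancel_right]
  have hpair : (D + L) * blockDiagonalPart ((· / 2) ∘ c) A⁻¹ = 1 :=
    hDL ▸ blockDiagonalPart_mul_blockDiagonalPart_inv hA₂ hu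
  rw [← Matrix.inv_eq_right_inv hpair, Matrix.inv_eq_right_inv hright]

end PairOfBlocks

section BilinearAlgorithm

/-- The linear combination of the blocks of `S` with the coefficients `γ`, where `S` is partitioned
into `d × d` blocks, which are matrices over `E`. -/
def blockCombination {d : ℕ} {E R : Type*} [NonUnitalNonAssocSemiring R]
    (γ : Matrix (Fin d) (Fin d) R) (S : Matrix (Fin d × E) (Fin d × E) R) : Matrix E E R :=
  Matrix.of fun x y => ∑ k, ∑ l, γ k l * S (k, x) (l, y)

variable {F : Type*} [Field F] {m t : ℕ}

/-- A bilinear algorithm does not use that the entries commute, hence it applies to matrices whose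
entries are matrices. -/
lemma HasAlgebraicMMAlgorithm.exists_block_mul_apply (E : Type*) [Fintype E]
    (h : HasAlgebraicMMAlgorithm F m m t) :
    ∃ α β lam : Fin t → Matrix (Fin m) (Fin m) F,
      ∀ (S T : Matrix (Fin m × E) (Fin m × E) F) (i j : Fin m) (x y : E),
        (S * T) (i, x) (j, y) =
          ∑ μ, lam μ i j * (blockCombination (α μ) S * blockCombination (β μ) T) x y := by
  obtain ⟨α, β, lam, h⟩ := h
  refine ⟨fun μ => Matrix.of fun k l => α k l μ, fun μ => Matrix.of fun l k => β k l μ,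
    fun μ => Matrix.of fun i j => lam i j μ, fun S T i j x y => ?_⟩
  have hfine (z : E) : ∑ k, S (i, x) (k, z) * T (k, z) (j, y) =
      ∑ μ, lam i j μ * ((∑ k, ∑ l, α k l μ * S (k, x) (l, z)) *
        ∑ l, ∑ k, β k l μ * T (l, z) (k, y)) := by
    have hswap (μ : Fin t) : ∑ k, ∑ l, β k l μ * T (l, z) (k, y) =
        ∑ l, ∑ k, β k l μ * T (l, z) (k, y) := Finset.sum_comm
    simpa only [Matrix.mul_apply, Matrix.of_apply, mul_assoc, hswap] using
      h (Matrix.of fun k l => S (k, x) (l, z)) (Matrix.of fun l k => T (l, z) (k, y)) i j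
  rw [Matrix.mul_apply, Fintype.sum_prod_type, Finset.sum_comm]
  simp only [hfine, blockCombination, Matrix.mul_apply, Matrix.of_apply, Finset.mul_sum (ι := E)]
  exact Finset.sum_comm

/-- The algorithm writes every `A = A * 1` as a linear combination of `t` matrices that do not
depend on `A`. -/
lemma HasAlgebraicMMAlgorithm.mul_self_le (h : HasAlgebraicMMAlgorithm F m m t) : m * m ≤ t := by
  obtain ⟨α, β, lam, h⟩ := h
  have hspan : ⊤ ≤ Submodule.span F (Set.range fun μ => Matrix.of fun i j => lam i j μ) := by
    rintro A -
    rw [Submodule.mem_span_range_iff_exists_fun]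
    refine ⟨fun μ => (∑ k, ∑ l, α k l μ * A k l) *
      ∑ k, ∑ l, β k l μ * (1 : Matrix (Fin m) (Fin m) F) l k, ?_⟩
    ext i j
    rw [← mul_one A, h A 1 i j, Matrix.sum_apply]
    simp only [mul_one, Matrix.smul_apply, Matrix.of_apply, smul_eq_mul]
    exact Finset.sum_congr rfl fun μ _ => by ring
  have hrank := finrank_range_le_card (R := F) fun μ : Fin t => Matrix.of fun i j => lam i j μ
  rw [Set.finrank, top_le_iff.1 hspan, finrank_top] at hrank
  simpa [Module.finrank_matrix] using hrank

lemma hasAlgebraicMMAlgorithm_cube (F : Type*) [Field F] (m : ℕ) :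
    HasAlgebraicMMAlgorithm F m m (m * m * m) := by
  let e : Fin (m * m * m) ≃ (Fin m × Fin m) × Fin m :=
    finProdFinEquiv.symm.trans (finProdFinEquiv.symm.prodCongr (Equiv.refl _))
  refine ⟨fun k l μ => if k = (e μ).1.1 then if l = (e μ).1.2 then 1 else 0 else 0,
    fun k l μ => if k = (e μ).2 then if l = (e μ).1.2 then 1 else 0 else 0,
    fun i j μ => if (e μ).1.1 = i then if (e μ).2 = j then 1 else 0 else 0, fun A B i j => ?_⟩
  rw [← e.symm.sum_comp, Matrix.mul_apply]
  simp [Fintype.sum_prod_type]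

end BilinearAlgorithm

section Exponent

variable {F : ℕ → Type*} [∀ n, Field (F n)] {τ : ℝ}

lemma SquareMMRankBigO.two_le (h : SquareMMRankBigO F τ) : 2 ≤ τ := by
  by_contra! hτ
  obtain ⟨K, hK⟩ := h
  have hle (m : ℕ) (hm : 1 ≤ m) : (m : ℝ) ^ (2 - τ) ≤ K := by
    obtain ⟨t, ht, halg⟩ := hK 1 le_rfl m hm
    have hm_pos : (0 : ℝ) < m := by exact_mod_cast hm
    rw [Real.rpow_sub hm_pos, div_le_iff₀ (Real.rpow_pos_of_pos hm_pos _), Real.rpow_two, sq]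
    exact le_trans (by exact_mod_cast halg.mul_self_le) ht
  have htendsto := (tendsto_rpow_atTop (sub_pos.2 hτ)).comp
    (tendsto_natCast_atTop_atTop (R := ℝ))
  obtain ⟨m, hm, hm_one⟩ :=
    ((htendsto.eventually_gt_atTop K).and (Filter.eventually_ge_atTop 1)).exists
  exact (hle m hm_one).not_gt hm

lemma squareMMRankBigO_of_three_le (F : ℕ → Type*) [∀ n, Field (F n)] (hτ : 3 ≤ τ) :
    SquareMMRankBigO F τ := by
  refine ⟨1, fun n _ m hm => ⟨m * m * m, ?_, hasAlgebraicMMAlgorithm_cube _ _⟩⟩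
  calc ((m * m * m : ℕ) : ℝ) = (m : ℝ) ^ (3 : ℝ) := by
        rw [Real.rpow_ofNat]; push_cast; ring
    _ ≤ 1 * (m : ℝ) ^ τ := by
        rw [one_mul]
        exact Real.rpow_le_rpow_of_exponent_le (by exact_mod_cast hm) hτ

lemma nonempty_setOf_squareMMRankBigO (F : ℕ → Type*) [∀ n, Field (F n)] :
    {τ : ℝ | ∀ ε : ℝ, 0 < ε → SquareMMRankBigO F (τ + ε)}.Nonempty :=
  ⟨3, fun _ hε => squareMMRankBigO_of_three_le F (le_add_of_nonneg_right hε.le)⟩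

lemma two_le_matMulExponent (F : ℕ → Type*) [∀ n, Field (F n)] : 2 ≤ matMulExponent F :=
  le_csInf (nonempty_setOf_squareMMRankBigO F) fun _ hτ =>
    le_of_forall_pos_le_add fun ε hε => (hτ ε hε).two_le

lemma squareMMRankBigO_of_matMulExponent_lt (h : matMulExponent F < τ) : SquareMMRankBigO F τ := by
  obtain ⟨σ, hσ, hlt⟩ := exists_lt_of_csInf_lt (nonempty_setOf_squareMMRankBigO F) h
  simpa using hσ (τ - σ) (sub_pos.2 hlt)

end Exponent

section Coloring

/-- Greedy colouring: a new vertex avoids the colours of its neighbours. -/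
lemma nonempty_coloring_of_degree_lt {V X : Type*} [Fintype V] [Fintype X] (G : SimpleGraph V)
    [DecidableRel G.Adj] (hG : ∀ v, G.degree v < Fintype.card X) : Nonempty (G.Coloring X) := by
  classical
  rcases isEmpty_or_nonempty V with hV | ⟨⟨v₀⟩⟩
  · exact ⟨.ofIsEmpty⟩
  have : Nonempty X := Fintype.card_pos_iff.1 ((Nat.zero_le _).trans_lt (hG v₀))
  suffices hpartial : ∀ s : Finset V, ∃ col : V → X, ∀ v ∈ s, ∀ w ∈ s, G.Adj v w →
      col v ≠ col w by
    obtain ⟨col, hcol⟩ := hpartial Finset.univ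
    exact ⟨.mk col fun {v w} => hcol v (Finset.mem_univ v) w (Finset.mem_univ w)⟩
  intro s
  induction s using Finset.induction_on with
  | empty => exact ⟨fun _ => Classical.arbitrary X, by simp⟩
  | insert a s _ ih =>
    obtain ⟨col, hcol⟩ := ih
    obtain ⟨x, -, hx⟩ : ∃ x ∈ Finset.univ, x ∉ (G.neighborFinset a).image col :=
      Finset.exists_mem_notMem_of_card_lt_card (Finset.card_image_le.trans_lt (hG a))
    have hfresh {w : V} (hw : G.Adj a w) : col w ≠ x := fun h =>
      hx (Finset.mem_image.2 ⟨w, (G.mem_neighborFinset a w).2 hw, h⟩)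
    refine ⟨Function.update col a x, fun v hv w hw hvw => ?_⟩
    grind [G.ne_of_adj hvw, G.adj_comm v w]

/-- The elements of `I` are the edges of a bipartite multigraph from `V` to `W`. -/
lemma exists_edge_coloring {I V W X : Type*} [Fintype I] [DecidableEq V] [DecidableEq W]
    [Fintype X] {src : I → V} {dst : I → W} {k : ℕ} (hsrc : ∀ v, #{i | src i = v} ≤ k)
    (hdst : ∀ w, #{i | dst i = w} ≤ k) (hX : 2 * k ≤ Fintype.card X) :
    ∃ col : I → X, Function.Injective (fun i => (src i, col i)) ∧
      Function.Injective (fun i => (col i, dst i)) := by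
  classical
  let G : SimpleGraph I := .fromRel fun i j => src i = src j ∨ dst i = dst j
  have hG (i : I) : G.degree i < Fintype.card X := by
    have hsub : G.neighborFinset i ⊆
        ({j | src j = src i} : Finset I).erase i ∪ ({j | dst j = dst i} : Finset I).erase i := by
      intro j hj
      simp only [G, SimpleGraph.mem_neighborFinset, SimpleGraph.fromRel_adj] at hj
      grind
    have hi_src := Finset.card_erase_lt_of_mem (s := {j | src j = src i}) (a := i) (by simp)
    have hi_dst := Finset.card_erase_lt_of_mem (s := {j | dst j = dst i}) (a := i) (by simp)
    have hunion := (Finset.card_le_card hsub).trans (Finset.card_union_le _ _)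
    rw [G.card_neighborFinset_eq_degree] at hunion
    have := hsrc (src i)
    have := hdst (dst i)
    lia
  obtain ⟨col⟩ := nonempty_coloring_of_degree_lt G hG
  have hproper {i j : I} (h : src i = src j ∨ dst i = dst j) (hc : col i = col j) : i = j := by
    by_contra hne
    exact col.valid ((SimpleGraph.fromRel_adj _ _ _).2 ⟨hne, .inl h⟩) hc
  exact ⟨col, fun i j h => hproper (.inl (congrArg Prod.fst h)) (congrArg Prod.snd h),
    fun i j h => hproper (.inr (congrArg Prod.snd h)) (congrArg Prod.fst h)⟩

end Coloring

section Fibers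

lemma exists_balanced_map (J : Type*) [Fintype J] {n : ℕ} (hn : 0 < n) :
    ∃ h : J → Fin n, ∀ v, n * #{j | h j = v} ≤ Fintype.card J + n := by
  let e := Fintype.equivFin J
  refine ⟨fun j => ⟨e j % n, Nat.mod_lt _ hn⟩, fun v => ?_⟩
  have hcard : #{j | (⟨e j % n, Nat.mod_lt _ hn⟩ : Fin n) = v} ≤ Fintype.card J / n + 1 := by
    rw [← Finset.card_range (Fintype.card J / n + 1)]
    refine Finset.card_le_card_of_injOn (fun j => (e j : ℕ) / n) (fun j _ => ?_) ?_
    · simpa [Nat.lt_succ_iff] using Nat.div_le_div_right (c := n) (e j).2.le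
    · intro i hi j hj (hij : (e i : ℕ) / n = e j / n)
      simp only [Finset.coe_filter, Finset.mem_univ, true_and, Set.mem_ofPred_eq,
        Fin.ext_iff] at hi hj
      refine e.injective (Fin.ext ?_)
      rw [← Nat.div_add_mod (e i : ℕ) n, ← Nat.div_add_mod (e j : ℕ) n, hi, hj, hij]
  calc n * #{j | (⟨e j % n, Nat.mod_lt _ hn⟩ : Fin n) = v} ≤ n * (Fintype.card J / n + 1) := by
        gcongr
    _ ≤ Fintype.card J + n := by
        rw [mul_add_one]
        gcongr
        exact Nat.mul_div_le _ _

lemma card_fiber_comp_le_of_injective {I J V D : Type*} [Fintype I] [Fintype J] [Fintype D]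
    [DecidableEq V] {f : I → J} {g : I → D} (hfg : Function.Injective fun i => (g i, f i))
    (h : J → V) (v : V) : #{i | h (f i) = v} ≤ Fintype.card D * #{j | h j = v} := by
  rw [← Finset.card_univ, ← Finset.card_product]
  exact Finset.card_le_card_of_injOn _ (fun i hi => by simpa using hi) hfg.injOn

end Fibers

/-- What the nodes know about the global input in `Ω`: node `v` cannot distinguish the inputs that
are related by the `v`-th relation. -/
abbrev Knowledge (n : ℕ) (Ω : Type*) := Fin n → Setoid Ω

namespace Knowledge

variable {n b : ℕ} {Ω : Type*} {K K' K'' : Knowledge n Ω}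

section Knows

variable {v : Fin n} {X Y R : Type*}

/-- The node `v` knows the value of `g` at the global input. -/
def Knows (K : Knowledge n Ω) (v : Fin n) (g : Ω → X) : Prop :=
  ∀ ⦃x y⦄, K v x y → g x = g y

lemma Knows.mono {g : Ω → X} (hg : K.Knows v g) (h : K' ≤ K) : K'.Knows v g :=
  fun _ _ hxy => hg (h v hxy)

lemma knows_const (K : Knowledge n Ω) (v : Fin n) (a : X) : K.Knows v fun _ => a :=
  fun _ _ _ => rfl

lemma Knows.comp {g : Ω → X} (hg : K.Knows v g) (φ : X → Y) : K.Knows v fun ω => φ (g ω) :=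
  fun _ _ hxy => congrArg φ (hg hxy)

lemma Knows.sub [Sub R] {f g : Ω → R} (hf : K.Knows v f) (hg : K.Knows v g) :
    K.Knows v fun ω => f ω - g ω :=
  fun _ _ hxy => congrArg₂ (· - ·) (hf hxy) (hg hxy)

lemma Knows.mul [Mul R] {f g : Ω → R} (hf : K.Knows v f) (hg : K.Knows v g) :
    K.Knows v fun ω => f ω * g ω :=
  fun _ _ hxy => congrArg₂ (· * ·) (hf hxy) (hg hxy)

lemma Knows.sum {ι : Type*} [AddCommMonoid R] {s : Finset ι} {g : ι → Ω → R}
    (hg : ∀ i ∈ s, K.Knows v (g i)) : K.Knows v fun ω => ∑ i ∈ s, g i ω :=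
  fun _ _ hxy => Finset.sum_congr rfl fun i hi => hg i hi hxy

end Knows

section Reach

/-- The knowledge of nodes each of which knows its own part of the input. -/
abbrev initial {In : Type*} (input : Ω → Fin n → In) : Knowledge n Ω :=
  fun v => Setoid.ker (input · v)

/-- The knowledge of the nodes after a round in which the message from `u` to `v` is
`msg u v ω`, where `ω` is the global input. -/
abbrev afterRound (K : Knowledge n Ω) (msg : Fin n → Fin n → Ω → Fin b → Bool) :
    Knowledge n Ω :=
  fun v => K v ⊓ Setoid.ker fun ω u => msg u v ω

lemma afterRound_le (K : Knowledge n Ω) (msg : Fin n → Fin n → Ω → Fin b → Bool) :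
    K.afterRound msg ≤ K := fun _ => inf_le_left

lemma knows_afterRound (K : Knowledge n Ω) (msg : Fin n → Fin n → Ω → Fin b → Bool)
    (u v : Fin n) : (K.afterRound msg).Knows v (msg u v) :=
  fun _ _ h => congrFun h.2 u

/-- `Reach b r K K'`: nodes with the knowledge `K` can gain the knowledge `K'` in `r` rounds with
messages of `b` bits. -/
inductive Reach (b : ℕ) : ℕ → Knowledge n Ω → Knowledge n Ω → Prop
  | refl (K : Knowledge n Ω) : Reach b 0 K K
  | step {r : ℕ} {K K' : Knowledge n Ω} (msg : Fin n → Fin n → Ω → Fin b → Bool) :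
      Reach b r K K' → (∀ u v, K'.Knows u (msg u v)) → Reach b (r + 1) K (K'.afterRound msg)

lemma Reach.le {r : ℕ} (h : Reach b r K K') : K' ≤ K := by
  induction h with
  | refl => exact le_rfl
  | step msg _ _ ih => exact (afterRound_le _ msg).trans ih

lemma Reach.trans {r s : ℕ} (h : Reach b r K K') (h' : Reach b s K' K'') :
    Reach b (r + s) K K'' := by
  induction h' with
  | refl => exact h
  | step msg _ hmsg ih => exact .step msg (ih h) hmsg

/-- The knowledge after `i` rounds in which the messages are given by `msg`. -/
abbrev afterRounds (K : Knowledge n Ω) (msg : ℕ → Fin n → Fin n → Ω → Fin b → Bool) :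
    ℕ → Knowledge n Ω
  | 0 => K
  | i + 1 => (afterRounds K msg i).afterRound (msg i)

lemma afterRounds_congr (K : Knowledge n Ω) {msg msg' : ℕ → Fin n → Fin n → Ω → Fin b → Bool}
    {r : ℕ} (h : ∀ i < r, msg i = msg' i) : K.afterRounds msg r = K.afterRounds msg' r := by
  induction r with
  | zero => rfl
  | succ r ih =>
    simp only [afterRounds]
    rw [ih fun i hi => h i (hi.trans r.lt_succ_self), h r r.lt_succ_self]

lemma Reach.exists_messages {r : ℕ} (h : Reach b r K K') :
    ∃ msg : ℕ → Fin n → Fin n → Ω → Fin b → Bool,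
      (∀ i < r, ∀ u v, (K.afterRounds msg i).Knows u (msg i u v)) ∧ K.afterRounds msg r = K' := by
  induction h with
  | refl K => exact ⟨fun _ _ _ _ _ => false, fun i hi => absurd hi i.not_lt_zero, rfl⟩
  | @step r K K' new _ hnew ih =>
    obtain ⟨msg, hmsg, rfl⟩ := ih
    have hprefix (j : ℕ) (hj : j ≤ r) :
        K.afterRounds (Function.update msg r new) j = K.afterRounds msg j :=
      K.afterRounds_congr fun i hi => Function.update_of_ne (hi.trans_le hj).ne _ _
    refine ⟨Function.update msg r new, fun i hi u v => ?_, ?_⟩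
    · rw [hprefix i (Nat.lt_succ_iff.1 hi)]
      rcases (Nat.lt_succ_iff.1 hi).eq_or_lt with rfl | hlt
      · simpa using hnew u v
      · simpa [Function.update_of_ne hlt.ne] using hmsg i hlt u v
    · simp [afterRounds, hprefix r le_rfl]

end Reach

section Protocol

universe u

variable {Ω In Out : Type u} {r : ℕ}

open Classical in
/-- The protocol in which the state of a node consists of the number of the round and of the set of
the inputs that are consistent with what the node has seen. In round `i` the node `u` sends
`msg i u v` to `v`, evaluated at any consistent input, and at the end it outputs `output`. -/
noncomputable def protocol [Inhabited Out] (input : Ω → Fin n → In) (output : Ω → Fin n → Out)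
    (msg : ℕ → Fin n → Fin n → Ω → Fin b → Bool) : CliqueProtocol n b In Out where
  State := ULift.{u} ℕ × Set Ω
  init v s := (⟨0⟩, {ω | input ω v = s})
  send u s v := if h : s.2.Nonempty then msg s.1.down u v h.some else fun _ => false
  recv v s m := (⟨s.1.down + 1⟩, {ω | ω ∈ s.2 ∧ ∀ u, msg s.1.down u v ω = m u})
  out v s := if h : s.2.Nonempty then output h.some v else default

variable [Inhabited Out] {input : Ω → Fin n → In} {output : Ω → Fin n → Out}
  {msg : ℕ → Fin n → Fin n → Ω → Fin b → Bool}

lemma stateAfter_protocol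
    (hmsg : ∀ i < r, ∀ u v, ((initial input).afterRounds msg i).Knows u (msg i u v)) (ω : Ω)
    {i : ℕ} (hi : i ≤ r) (v : Fin n) :
    (protocol input output msg).stateAfter (input ω) i v =
      (⟨i⟩, {ω' | (initial input).afterRounds msg i v ω' ω}) := by
  induction i generalizing v with
  | zero => rfl
  | succ i ih =>
    have ih' := ih (i.le_succ.trans hi)
    have hsend (u : Fin n) : (protocol input output msg).send u
        ((protocol input output msg).stateAfter (input ω) i u) v = msg i u v ω := by
      have hne : {ω' | (initial input).afterRounds msg i u ω' ω}.Nonempty :=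
        ⟨ω, Setoid.refl' _ ω⟩
      rw [ih']
      exact (dif_pos hne).trans (hmsg i hi u v hne.some_mem)
    simp only [CliqueProtocol.stateAfter, hsend]
    rw [ih']
    refine Prod.ext rfl (Set.ext fun ω' => and_congr_right fun _ => ?_)
    exact funext_iff.symm

lemma Reach.exists_protocol {K : Knowledge n Ω} (h : Reach b r (initial input) K)
    (hout : ∀ v, K.Knows v (output · v)) :
    ∃ P : CliqueProtocol n b In Out, ∀ ω v, P.outputAfter (input ω) r v = output ω v := by
  obtain ⟨msg, hmsg, rfl⟩ := h.exists_messages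
  refine ⟨protocol input output msg, fun ω v => ?_⟩
  have hne : {ω' | (initial input).afterRounds msg r v ω' ω}.Nonempty := ⟨ω, Setoid.refl' _ ω⟩
  rw [CliqueProtocol.outputAfter, stateAfter_protocol hmsg ω le_rfl]
  exact (dif_pos hne).trans (hout v hne.some_mem)

end Protocol

section Routing

variable {F I : Type*} {c : ℕ} {code : F → Fin c → Fin b → Bool} {src dst : I → Fin n}
  {val : I → Ω → F}

lemma reach_of_knows (K : Knowledge n Ω) {q : ℕ}
    (msg : Fin q → Fin n → Fin n → Ω → Fin b → Bool)
    (hmsg : ∀ i u v, K.Knows u (msg i u v)) :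
    ∃ K', Reach b q K K' ∧ ∀ i u v, K'.Knows v (msg i u v) := by
  induction q with
  | zero => exact ⟨K, .refl K, fun i => i.elim0⟩
  | succ q ih =>
    obtain ⟨K', hK', h⟩ := ih (fun i => msg i.castSucc) fun i => hmsg i.castSucc
    refine ⟨K'.afterRound (msg (Fin.last q)),
      .step _ hK' fun u v => (hmsg (Fin.last q) u v).mono hK'.le, fun i u v => ?_⟩
    induction i using Fin.lastCases with
    | last => exact knows_afterRound K' _ u v
    | cast i => exact (h i u v).mono (afterRound_le _ _)

/-- The item `i` is sent over the link from `src i` to `dst i` in the time slot `slot i`, which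
consists of `c` rounds. -/
lemma exists_reach_direct (K : Knowledge n Ω) (hcode : Function.Injective code) {q : ℕ}
    {slot : I → Fin q} (hslot : Function.Injective fun i => (src i, dst i, slot i))
    (hval : ∀ i, K.Knows (src i) (val i)) :
    ∃ K', Reach b (q * c) K K' ∧ ∀ i, K'.Knows (dst i) (val i) := by
  let packet (j : Fin (q * c)) (u v : Fin n) (ω : Ω) : Fin b → Bool :=
    Function.extend (fun i => (src i, dst i, slot i))
      (fun i => code (val i ω) (finProdFinEquiv.symm j).2) (fun _ _ => false)
      (u, v, (finProdFinEquiv.symm j).1)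
  have hpacket (j : Fin (q * c)) (u v : Fin n) : K.Knows u (packet j u v) := by
    by_cases h : ∃ i, (src i, dst i, slot i) = (u, v, (finProdFinEquiv.symm j).1)
    · obtain ⟨i, hi⟩ := h
      obtain rfl : src i = u := congrArg Prod.fst hi
      simp only [packet, ← hi, hslot.extend_apply]
      exact (hval i).comp fun a => code a (finProdFinEquiv.symm j).2
    · simp only [packet, Function.extend_apply' _ _ _ h]
      exact K.knows_const u _
  obtain ⟨K', hK', h⟩ := K.reach_of_knows packet hpacket
  refine ⟨K', hK', fun i ω ω' hω => hcode (funext fun a => ?_)⟩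
  have hi := h (finProdFinEquiv (slot i, a)) (src i) (dst i) hω
  simpa only [packet, Equiv.symm_apply_apply, hslot.extend_apply] using hi

/-- Every item travels through an intermediate node: an edge colouring assigns to each item such a
node and a time slot, so that the items meet on no link. -/
theorem exists_reach_route [Fintype I] (K : Knowledge n Ω) (hcode : Function.Injective code) {k : ℕ}
    (hsrc : ∀ v, #{i | src i = v} ≤ k * n) (hdst : ∀ v, #{i | dst i = v} ≤ k * n)
    (hval : ∀ i, K.Knows (src i) (val i)) :
    ∃ K', Reach b (4 * k * c) K K' ∧ ∀ i, K'.Knows (dst i) (val i) := by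
  obtain ⟨col, hcol_src, hcol_dst⟩ := exists_edge_coloring (X := Fin n × Fin (2 * k)) hsrc hdst
    (by simp only [Fintype.card_prod, Fintype.card_fin]; exact le_of_eq (by ring))
  obtain ⟨K₁, hK₁, h₁⟩ := K.exists_reach_direct hcode (dst := fun i => (col i).1)
    (slot := fun i => (col i).2) hcol_src hval
  obtain ⟨K₂, hK₂, h₂⟩ := K₁.exists_reach_direct hcode (src := fun i => (col i).1) (dst := dst)
    (slot := fun i => (col i).2) (fun i j h => hcol_dst (by grind)) h₁
  refine ⟨K₂, ?_, h₂⟩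
  convert hK₁.trans hK₂ using 1
  ring

end Routing

section KnowsShares

variable {R : Type*} {S T : Ω → Matrix (Fin n) (Fin n) R}

/-- The nodes `i` and `j` know the entry `(i, j)` of a matrix that depends on the global input. In
other words, every node knows its row and its column. -/
def KnowsShares (K : Knowledge n Ω) (S : Ω → Matrix (Fin n) (Fin n) R) : Prop :=
  ∀ i j, K.Knows i (fun ω => S ω i j) ∧ K.Knows j (fun ω => S ω i j)

lemma knowsShares_iff :
    K.KnowsShares S ↔ ∀ v, K.Knows v fun ω => nodeShare (S ω) v := by
  refine ⟨fun h v x y hxy => ?_, fun h i j => ?_⟩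
  · exact Prod.ext (funext fun j => (h v j).1 hxy) (funext fun i => (h i v).2 hxy)
  · exact ⟨(h i).comp fun share => share.1 j, (h j).comp fun share => share.2 i⟩

lemma KnowsShares.mono (h : K.KnowsShares S) (hK : K' ≤ K) : K'.KnowsShares S :=
  fun i j => ⟨(h i j).1.mono hK, (h i j).2.mono hK⟩

lemma KnowsShares.sub [AddGroup R] (hS : K.KnowsShares S) (hT : K.KnowsShares T) :
    K.KnowsShares fun ω => S ω - T ω :=
  fun i j => ⟨(hS i j).1.sub (hT i j).1, (hS i j).2.sub (hT i j).2⟩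

lemma KnowsShares.blockDiagonalPart [Zero R] {α : Type*} [DecidableEq α] (hS : K.KnowsShares S)
    (c : Fin n → α) : K.KnowsShares fun ω => blockDiagonalPart c (S ω) :=
  fun i j => ⟨(hS i j).1.comp fun a => if c i = c j then a else 0,
    (hS i j).2.comp fun a => if c i = c j then a else 0⟩

end KnowsShares

end Knowledge

section PaddedBlock

variable {ι κ D R : Type*} {pos : ι → κ × D}

/-- The block of index `a` of the matrix `S`, padded with zeros to a matrix over `D`, where
`pos i = (a, p)` means that the index `i` has the place `p` in the block `a`. -/
noncomputable def paddedBlock [Zero R] (pos : ι → κ × D) (S : Matrix ι ι R) (a : κ) :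
    Matrix D D R :=
  Matrix.of fun p q => Function.extend (Prod.map pos pos) (fun z => S z.1 z.2) 0 ((a, p), (a, q))

lemma paddedBlock_apply [Zero R] (hpos : Function.Injective pos) (S : Matrix ι ι R) {i j : ι}
    {a : κ} {p q : D} (hi : pos i = (a, p)) (hj : pos j = (a, q)) :
    paddedBlock pos S a p q = S i j := by
  have h := (hpos.prodMap hpos).extend_apply (fun z => S z.1 z.2) 0 (i, j)
  rwa [Prod.map_apply, hi, hj] at h

lemma paddedBlock_eq_zero [Zero R] (S : Matrix ι ι R) {a : κ} {p q : D}
    (h : ¬ ∃ i j, pos i = (a, p) ∧ pos j = (a, q)) : paddedBlock pos S a p q = 0 := by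
  rw [paddedBlock, Matrix.of_apply, Function.extend_apply', Pi.zero_apply]
  rintro ⟨⟨i, j⟩, hij⟩
  exact h ⟨i, j, congrArg Prod.fst hij, congrArg Prod.snd hij⟩

lemma paddedBlock_mul [Fintype ι] [Fintype D] [NonUnitalNonAssocSemiring R]
    (hpos : Function.Injective pos) {S : Matrix ι ι R}
    (hS : IsBlockDiagonal (fun i => (pos i).1) S) (T : Matrix ι ι R) (a : κ) :
    paddedBlock pos (S * T) a = paddedBlock pos S a * paddedBlock pos T a := by
  classical
  ext p q
  rw [Matrix.mul_apply]
  by_cases h : ∃ i j, pos i = (a, p) ∧ pos j = (a, q)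
  · obtain ⟨i, j, hi, hj⟩ := h
    have hsupp (l : ι) (hl : S i l * T l j ≠ 0) : (pos l).1 = a := by
      by_contra hla
      exact hl (by rw [hS i l (by simpa [hi] using Ne.symm hla), zero_mul])
    rw [paddedBlock_apply hpos _ hi hj, Matrix.mul_apply,
      ← Finset.sum_filter_of_ne fun l _ => hsupp l]
    refine Finset.sum_of_injOn (fun l => (pos l).2) ?_ (by simp) ?_ ?_
    · exact fun l hl l' hl' h => hpos (Prod.ext (by simp_all) h)
    · intro r _ hr
      rw [paddedBlock_eq_zero S, zero_mul]
      rintro ⟨_, l, -, hl⟩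
      exact hr ⟨l, by simp [hl], by simp [hl]⟩
    · intro l hl
      have hpos_l : pos l = (a, (pos l).2) := Prod.ext (Finset.mem_filter.1 hl).2 rfl
      rw [paddedBlock_apply hpos S hi hpos_l, paddedBlock_apply hpos T hpos_l hj]
  · rw [paddedBlock_eq_zero _ h]
    refine (Finset.sum_eq_zero fun r _ => ?_).symm
    by_cases hp : ∃ i, pos i = (a, p)
    · rw [paddedBlock_eq_zero T (by grind), mul_zero]
    · rw [paddedBlock_eq_zero S (by grind), zero_mul]

end PaddedBlock

/-- A distribution over `n` nodes of the product of block diagonal `n × n` matrices with at most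
`P` blocks. Each block is a `d × d` matrix of `e × e` matrices, and it is multiplied by a bilinear
algorithm of rank `t` for `d × d` matrices. The index `i` is in the block, at the coarse place and
at the fine place `pos i`. The node `host (a, x, y)` collects the entries of the block `a` at the
fine place `(x, y)`, and the node `worker (a, μ)` computes the `μ`-th product for the block `a`.
Every node handles at most `κ * n` elements of the field in each phase. -/
structure BlockLayout (n P d e t κ : ℕ) where
  pos : Fin n → Fin P × Fin d × Fin e
  pos_injective : Function.Injective pos
  host : Fin P × Fin e × Fin e → Fin n
  worker : Fin P × Fin t → Fin n
  load_pos : 0 < κ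
  mul_self_le : d * d ≤ t
  host_load (v : Fin n) : t * #{j | host j = v} ≤ κ * n
  worker_load (v : Fin n) : e * e * #{j | worker j = v} ≤ κ * n

namespace BlockLayout

variable {n P d e t κ b c : ℕ} (L : BlockLayout n P d e t κ)

/-- The entries of an `n × n` matrix in the diagonal blocks. -/
abbrev Entry : Type := {p : Fin n × Fin n // (L.pos p.1).1 = (L.pos p.2).1}

/-- The node that collects the entry `p`. -/
def entryHost (p : L.Entry) : Fin n :=
  L.host ((L.pos p.1.1).1, (L.pos p.1.1).2.2, (L.pos p.1.2).2.2)

lemma card_entry_row_le (v : Fin n) : #{p : L.Entry | p.1.1 = v} ≤ κ * n := by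
  refine (Finset.card_le_card_of_injOn (t := Finset.univ) (fun p => p.1.2) (by simp) ?_).trans ?_
  · exact fun p hp q hq h => Subtype.ext (Prod.ext (by simp_all) h)
  · simpa using Nat.le_mul_of_pos_left n L.load_pos

lemma card_entry_col_le (v : Fin n) : #{p : L.Entry | p.1.2 = v} ≤ κ * n := by
  refine (Finset.card_le_card_of_injOn (t := Finset.univ) (fun p => p.1.1) (by simp) ?_).trans ?_
  · exact fun p hp q hq h => Subtype.ext (Prod.ext h (by simp_all))
  · simpa using Nat.le_mul_of_pos_left n L.load_pos

lemma card_entryHost_le (v : Fin n) : #{p | L.entryHost p = v} ≤ κ * n := by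
  refine (card_fiber_comp_le_of_injective
    (g := fun p : L.Entry => ((L.pos p.1.1).2.1, (L.pos p.1.2).2.1)) ?_ L.host v).trans ?_
  · rintro ⟨⟨i, j⟩, hij⟩ ⟨⟨i', j'⟩, hij'⟩ h
    simp only [Prod.mk.injEq] at h hij hij'
    have hi : L.pos i = L.pos i' := by grind
    have hj : L.pos j = L.pos j' := by grind
    rw [Subtype.mk.injEq, L.pos_injective hi, L.pos_injective hj]
  · simpa using (Nat.mul_le_mul_right _ L.mul_self_le).trans (L.host_load v)

lemma card_product_host_le (v : Fin n) :
    #{p : (Fin P × Fin e × Fin e) × Fin t | L.host p.1 = v} ≤ κ * n := by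
  refine (card_fiber_comp_le_of_injective (g := Prod.snd) Prod.swap_injective L.host v).trans ?_
  simpa using L.host_load v

lemma card_product_worker_le (v : Fin n) :
    #{p : (Fin P × Fin e × Fin e) × Fin t | L.worker (p.1.1, p.2) = v} ≤ κ * n := by
  refine (card_fiber_comp_le_of_injective (g := fun p => p.1.2)
    (f := fun p : (Fin P × Fin e × Fin e) × Fin t => (p.1.1, p.2)) ?_ L.worker v).trans ?_
  · intro p q h
    grind
  · simpa using L.worker_load v

variable {Ω F : Type*} [Field F] {K : Knowledge n Ω} {code : F → Fin c → Fin b → Bool}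
  {S T X : Ω → Matrix (Fin n) (Fin n) F}

/-- Each host knows the entries of the matrix `X ω` at its fine place. -/
def HostsKnow (K : Knowledge n Ω) (X : Ω → Matrix (Fin n) (Fin n) F) : Prop :=
  ∀ a x y k l, K.Knows (L.host (a, x, y)) fun ω => paddedBlock L.pos (X ω) a (k, x) (l, y)

variable {L}

lemma HostsKnow.mono {K' : Knowledge n Ω} (h : L.HostsKnow K X) (hK : K' ≤ K) :
    L.HostsKnow K' X :=
  fun a x y k l => (h a x y k l).mono hK

lemma HostsKnow.knows_entry (h : L.HostsKnow K X) (p : L.Entry) :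
    K.Knows (L.entryHost p) fun ω => X ω p.1.1 p.1.2 := by
  have hentry (ω : Ω) := paddedBlock_apply L.pos_injective (X ω) (i := p.1.1) (j := p.1.2)
    (p := (L.pos p.1.1).2) (q := (L.pos p.1.2).2) rfl (Prod.ext p.2.symm rfl)
  simp only [← hentry]
  exact h _ _ _ _ _

lemma HostsKnow.knows_blockCombination (h : L.HostsKnow K X) (γ : Matrix (Fin d) (Fin d) F)
    (a : Fin P) (x y : Fin e) :
    K.Knows (L.host (a, x, y)) fun ω => blockCombination γ (paddedBlock L.pos (X ω) a) x y := by
  simp only [blockCombination, Matrix.of_apply]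
  exact .sum fun k _ => .sum fun l _ => (K.knows_const _ _).mul (h a x y k l)

variable (L)

theorem exists_reach_hostsKnow (hcode : Function.Injective code) (hX : K.KnowsShares X) :
    ∃ K', Knowledge.Reach b (4 * κ * c) K K' ∧ L.HostsKnow K' X := by
  obtain ⟨K', hK', h⟩ := K.exists_reach_route hcode L.card_entry_row_le L.card_entryHost_le
    (val := fun p ω => X ω p.1.1 p.1.2) fun p => (hX _ _).1
  refine ⟨K', hK', fun a x y k l => ?_⟩
  by_cases hex : ∃ i j, L.pos i = (a, k, x) ∧ L.pos j = (a, l, y)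
  · obtain ⟨i, j, hi, hj⟩ := hex
    simpa only [paddedBlock_apply L.pos_injective _ hi hj, entryHost, hi, hj] using
      h ⟨(i, j), by rw [hi, hj]⟩
  · simp only [paddedBlock_eq_zero _ hex]
    exact K'.knows_const _ _

theorem exists_reach_hostsKnow_mul (hcode : Function.Injective code)
    (halg : HasAlgebraicMMAlgorithm F d d t)
    (hdiag : ∀ ω, IsBlockDiagonal (fun i => (L.pos i).1) (S ω))
    (hS : L.HostsKnow K S) (hT : L.HostsKnow K T) :
    ∃ K', Knowledge.Reach b (3 * (4 * κ * c)) K K' ∧ L.HostsKnow K' fun ω => S ω * T ω := by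
  obtain ⟨α, β, lam, hmul⟩ := halg.exists_block_mul_apply (Fin e)
  obtain ⟨K₁, hK₁, h₁⟩ := K.exists_reach_route hcode
    L.card_product_host_le L.card_product_worker_le
    fun p => hS.knows_blockCombination (α p.2) p.1.1 p.1.2.1 p.1.2.2
  obtain ⟨K₂, hK₂, h₂⟩ := K₁.exists_reach_route hcode
    L.card_product_host_le L.card_product_worker_le
    fun p => (hT.mono hK₁.le).knows_blockCombination (β p.2) p.1.1 p.1.2.1 p.1.2.2
  obtain ⟨K₃, hK₃, h₃⟩ := K₂.exists_reach_route hcode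
    L.card_product_worker_le L.card_product_host_le
    (val := fun p ω => (blockCombination (α p.2) (paddedBlock L.pos (S ω) p.1.1) *
      blockCombination (β p.2) (paddedBlock L.pos (T ω) p.1.1)) p.1.2.1 p.1.2.2)
    fun p => by
      simp only [Matrix.mul_apply]
      exact .sum fun z _ => ((h₁ ((p.1.1, p.1.2.1, z), p.2)).mono hK₂.le).mul
        (h₂ ((p.1.1, z, p.1.2.2), p.2))
  refine ⟨K₃, ?_, fun a x y k l => ?_⟩
  · convert (hK₁.trans hK₂).trans hK₃ using 1
    ring
  · simp only [paddedBlock_mul L.pos_injective (hdiag _), hmul]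
    exact .sum fun μ _ => (K₃.knows_const _ _).mul (h₃ ((a, x, y), μ))

theorem exists_reach_knowsShares (hcode : Function.Injective code)
    (hdiag : ∀ ω, IsBlockDiagonal (fun i => (L.pos i).1) (X ω)) (hX : L.HostsKnow K X) :
    ∃ K', Knowledge.Reach b (2 * (4 * κ * c)) K K' ∧ K'.KnowsShares X := by
  obtain ⟨K₁, hK₁, h₁⟩ := K.exists_reach_route hcode L.card_entryHost_le L.card_entry_row_le
    hX.knows_entry
  obtain ⟨K₂, hK₂, h₂⟩ := K₁.exists_reach_route hcode L.card_entryHost_le L.card_entry_col_le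
    (hX.mono hK₁.le).knows_entry
  refine ⟨K₂, two_mul (4 * κ * c) ▸ hK₁.trans hK₂, fun i j => ?_⟩
  by_cases hij : (L.pos i).1 = (L.pos j).1
  · exact ⟨(h₁ ⟨(i, j), hij⟩).mono hK₂.le, h₂ ⟨(i, j), hij⟩⟩
  · simp only [hdiag _ i j hij]
    exact ⟨K₂.knows_const _ _, K₂.knows_const _ _⟩

theorem exists_reach_knowsShares_mul (hcode : Function.Injective code)
    (halg : HasAlgebraicMMAlgorithm F d d t)
    (hS_diag : ∀ ω, IsBlockDiagonal (fun i => (L.pos i).1) (S ω))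
    (hT_diag : ∀ ω, IsBlockDiagonal (fun i => (L.pos i).1) (T ω))
    (hS : K.KnowsShares S) (hT : K.KnowsShares T) :
    ∃ K', Knowledge.Reach b (7 * (4 * κ * c)) K K' ∧ K'.KnowsShares fun ω => S ω * T ω := by
  obtain ⟨K₁, hK₁, h₁⟩ := L.exists_reach_hostsKnow hcode hS
  obtain ⟨K₂, hK₂, h₂⟩ := L.exists_reach_hostsKnow hcode (hT.mono hK₁.le)
  obtain ⟨K₃, hK₃, h₃⟩ := L.exists_reach_hostsKnow_mul hcode halg hS_diag (h₁.mono hK₂.le) h₂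
  obtain ⟨K₄, hK₄, h₄⟩ :=
    L.exists_reach_knowsShares hcode (fun ω => (hS_diag ω).mul (hT_diag ω)) h₃
  refine ⟨K₄, ?_, h₄⟩
  convert ((hK₁.trans hK₂).trans hK₃).trans hK₄ using 1
  ring

end BlockLayout

section Parameters

lemma exists_block_position {n P M d e : ℕ} (hM : 0 < M) (hPM : n ≤ P * M) (hde : M ≤ d * e) :
    ∃ pos : Fin n → Fin P × Fin d × Fin e,
      Function.Injective pos ∧ ∀ i, ((pos i).1 : ℕ) = i / M := by
  have he : 0 < e := Nat.pos_of_mul_pos_left (hM.trans_le hde)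
  refine ⟨fun i => (⟨i / M, Nat.div_lt_of_lt_mul (by rw [mul_comm]; omega)⟩,
    ⟨i % M / e, Nat.div_lt_of_lt_mul (by rw [mul_comm]; exact (Nat.mod_lt _ hM).trans_le hde)⟩,
    ⟨i % M % e, Nat.mod_lt _ he⟩), fun i j h => ?_, fun i => rfl⟩
  simp only [Prod.mk.injEq, Fin.mk.injEq] at h
  obtain ⟨hdiv, hmod_div, hmod_mod⟩ := h
  have hmod : (i : ℕ) % M = j % M := by
    rw [← Nat.div_add_mod ((i : ℕ) % M) e, hmod_div, hmod_mod, Nat.div_add_mod]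
  rw [Fin.ext_iff, ← Nat.div_add_mod (i : ℕ) M, hdiv, hmod, Nat.div_add_mod]

lemma exists_blockLayout_of_rank_le {n M d e t a : ℕ} (hn : 0 < n) (hM : 0 < M) (hMn : M ≤ 2 * n)
    (hde : M ≤ d * e) (hdt : d * d ≤ t) (ht : t ≤ a * M) :
    ∃ (P : ℕ) (L : BlockLayout n P d e t ((3 * a + 1) * (e * e / n + 2))),
      ∀ i, ((L.pos i).1 : ℕ) = i / M := by
  set P := n / M + 1
  set k := e * e / n + 1
  have hnP : n ≤ P * M := by simpa only [mul_comm] using (Nat.lt_mul_div_succ n hM).le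
  have hPt : P * t ≤ 3 * a * n := by
    have hPM : P * M ≤ 3 * n := by
      have := Nat.div_mul_le_self n M
      simp only [P, add_mul]
      omega
    nlinarith [Nat.mul_le_mul_left P ht, Nat.mul_le_mul_left a hPM]
  have htn : t ≤ 3 * a * n := (Nat.le_mul_of_pos_left t (Nat.succ_pos _)).trans hPt
  have hen : e * e ≤ k * n := by simpa only [mul_comm] using (Nat.lt_mul_div_succ (e * e) hn).le
  obtain ⟨pos, hpos, hpos_fst⟩ := exists_block_position hM hnP hde
  obtain ⟨host, hhost⟩ := exists_balanced_map (Fin P × Fin e × Fin e) hn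
  obtain ⟨worker, hworker⟩ := exists_balanced_map (Fin P × Fin t) hn
  simp only [Fintype.card_prod, Fintype.card_fin] at hhost hworker
  refine ⟨P, ⟨pos, hpos, host, worker, by positivity, hdt, fun v => ?_, fun v => ?_⟩, hpos_fst⟩
  · refine Nat.le_of_mul_le_mul_left ?_ hn
    calc n * (t * #{j | host j = v}) = t * (n * #{j | host j = v}) := by ring
      _ ≤ t * (P * (e * e) + n) := Nat.mul_le_mul_left t (hhost v)
      _ = P * t * (e * e) + t * n := by ring
      _ ≤ 3 * a * n * (k * n) + 3 * a * n * n := by gcongr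
      _ = n * (3 * a * (k + 1) * n) := by ring
      _ ≤ n * ((3 * a + 1) * (k + 1) * n) := by gcongr; omega
  · refine Nat.le_of_mul_le_mul_left ?_ hn
    calc n * (e * e * #{j | worker j = v}) = e * e * (n * #{j | worker j = v}) := by ring
      _ ≤ k * n * (3 * a * n + n) := by
        gcongr
        exact (hworker v).trans (by gcongr)
      _ = n * ((3 * a + 1) * k * n) := by ring
      _ ≤ n * ((3 * a + 1) * (k + 1) * n) := by gcongr; omega

lemma exists_block_dimensions {τ : ℝ} (hτ : 1 ≤ τ) {M : ℕ} (hM : 1 ≤ M) :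
    ∃ d e : ℕ, 1 ≤ d ∧ (d : ℝ) ^ τ ≤ M ∧ M ≤ d * e ∧ (e : ℝ) ≤ 3 * (M : ℝ) ^ (1 - 1 / τ) := by
  have hM1 : (1 : ℝ) ≤ M := by exact_mod_cast hM
  have hM0 : (0 : ℝ) < M := by linarith
  have hτ0 : 0 < τ := by linarith
  set x := (M : ℝ) ^ (1 / τ)
  set y := (M : ℝ) ^ (1 - 1 / τ)
  have hx : 1 ≤ x := Real.one_le_rpow hM1 (by positivity)
  have hy : 1 ≤ y := Real.one_le_rpow hM1 (by rw [sub_nonneg, div_le_one hτ0]; exact hτ)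
  have hxy : y * x = M := by rw [← Real.rpow_add hM0, sub_add_cancel, Real.rpow_one]
  have hd : 1 ≤ ⌊x⌋₊ := Nat.floor_pos.2 hx
  have hdx : (⌊x⌋₊ : ℝ) ≤ x := Nat.floor_le (by positivity)
  have hxd : x ≤ 2 * ⌊x⌋₊ := by
    have : (1 : ℝ) ≤ ⌊x⌋₊ := by exact_mod_cast hd
    linarith [Nat.lt_floor_add_one x]
  refine ⟨⌊x⌋₊, M / ⌊x⌋₊ + 1, hd, ?_, (Nat.lt_mul_div_succ M hd).le, ?_⟩
  · calc (⌊x⌋₊ : ℝ) ^ τ ≤ x ^ τ := by gcongr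
      _ = M := by rw [← Real.rpow_mul hM0.le, one_div_mul_cancel hτ0.ne', Real.rpow_one]
  · have hdiv : (M : ℝ) / ⌊x⌋₊ ≤ 2 * y := by
      rw [div_le_iff₀ (by exact_mod_cast hd), ← hxy]
      nlinarith
    have hcast : ((M / ⌊x⌋₊ : ℕ) : ℝ) ≤ (M : ℝ) / ⌊x⌋₊ := Nat.cast_div_le
    push_cast
    linarith

lemma mul_self_div_add_two_le {τ : ℝ} (hτ : 2 ≤ τ) {n M e : ℕ} (hn : 1 ≤ n) (hM : 1 ≤ M)
    (hMn : M ≤ 2 * n) (he : (e : ℝ) ≤ 3 * (M : ℝ) ^ (1 - 1 / τ)) :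
    ((e * e / n + 2 : ℕ) : ℝ) ≤ 20 * (M : ℝ) ^ (1 - 2 / τ) := by
  have hn0 : (0 : ℝ) < n := by exact_mod_cast hn
  have hM1 : (1 : ℝ) ≤ M := by exact_mod_cast hM
  have hM0 : (0 : ℝ) < M := by linarith
  have hMn' : (M : ℝ) ≤ 2 * n := by exact_mod_cast hMn
  set z := (M : ℝ) ^ (1 - 2 / τ)
  have hz : 1 ≤ z :=
    Real.one_le_rpow hM1 (by rw [sub_nonneg, div_le_one (by linarith)]; exact hτ)
  have hsq : (M : ℝ) ^ (1 - 1 / τ) * (M : ℝ) ^ (1 - 1 / τ) = M * z := by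
    rw [← Real.rpow_add hM0, mul_comm, ← Real.rpow_add_one hM0.ne']
    ring_nf
  have hdiv : ((e * e / n : ℕ) : ℝ) ≤ 18 * z :=
    calc ((e * e / n : ℕ) : ℝ) ≤ (e * e : ℕ) / (n : ℝ) := Nat.cast_div_le
      _ ≤ 18 * z := by
        rw [div_le_iff₀ hn0, Nat.cast_mul]
        calc (e : ℝ) * e ≤ (3 * (M : ℝ) ^ (1 - 1 / τ)) * (3 * (M : ℝ) ^ (1 - 1 / τ)) := by gcongr
          _ = 9 * z * M := by linear_combination 9 * hsq
          _ ≤ 9 * z * (2 * n) := by gcongr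
          _ = 18 * z * n := by ring
  push_cast
  linarith

/-- Products of `n × n` matrices over `F` with diagonal blocks of size `M` can be distributed over
the nodes with load at most `x`, by a bilinear algorithm for smaller matrices. -/
def HasBlockLayout (F : Type*) [Field F] (n M : ℕ) (x : ℝ) : Prop :=
  ∃ P d e t κ : ℕ, HasAlgebraicMMAlgorithm F d d t ∧ (κ : ℝ) ≤ x ∧
    ∃ L : BlockLayout n P d e t κ, ∀ i, ((L.pos i).1 : ℕ) = i / M

theorem SquareMMRankBigO.exists_hasBlockLayout {F : ℕ → Type*} [∀ n, Field (F n)] {τ : ℝ}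
    (h : SquareMMRankBigO F τ) :
    ∃ C : ℝ, 0 ≤ C ∧ ∀ n M : ℕ, 1 ≤ n → 1 ≤ M → M ≤ 2 * n →
      HasBlockLayout (F n) n M (C * (M : ℝ) ^ (1 - 2 / τ)) := by
  have hτ := h.two_le
  obtain ⟨K, hK⟩ := h
  refine ⟨(3 * ⌈K⌉₊ + 1) * 20, by positivity, fun n M hn hM hMn => ?_⟩
  obtain ⟨d, e, hd, hdM, hde, he⟩ := exists_block_dimensions (by linarith : 1 ≤ τ) hM
  obtain ⟨t, ht, halg⟩ := hK n hn d hd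
  have htM : t ≤ ⌈K⌉₊ * M := by
    have : (t : ℝ) ≤ ⌈K⌉₊ * M := ht.trans (by gcongr; exact Nat.le_ceil K)
    exact_mod_cast this
  obtain ⟨P, L, hL⟩ := exists_blockLayout_of_rank_le hn hM hMn hde halg.mul_self_le htM
  refine ⟨P, d, e, t, _, halg, ?_, L, hL⟩
  rw [Nat.cast_mul, mul_assoc]
  push_cast
  gcongr
  exact_mod_cast mul_self_div_add_two_le hτ hn hM hMn he

lemma exists_sum_range_clog_rpow_le {δ : ℝ} (hδ : 0 < δ) :
    ∃ C : ℝ, ∀ n : ℕ, 1 ≤ n →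
      ∑ i ∈ Finset.range (Nat.clog 2 n), ((2 ^ (i + 1) : ℕ) : ℝ) ^ δ ≤ C * (n : ℝ) ^ δ := by
  set y := (2 : ℝ) ^ δ
  have hy : 1 < y := Real.one_lt_rpow one_lt_two hδ
  refine ⟨y * y / (y - 1), fun n hn => ?_⟩
  set l := Nat.clog 2 n
  have hpow (i : ℕ) : ((2 ^ i : ℕ) : ℝ) ^ δ = y ^ i := by
    rw [Nat.cast_pow, Nat.cast_ofNat, Real.rpow_pow_comm two_pos.le]
  have hl_le : 2 ^ l ≤ 2 * n := by
    rcases hl' : l with _ | k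
    · omega
    · have : 2 ^ k < n := Nat.pow_lt_of_lt_clog (by omega)
      omega
  have hy_le : y ^ l ≤ y * (n : ℝ) ^ δ := by
    rw [← hpow, ← Real.mul_rpow two_pos.le n.cast_nonneg]
    gcongr
    exact_mod_cast hl_le
  calc ∑ i ∈ Finset.range l, ((2 ^ (i + 1) : ℕ) : ℝ) ^ δ = y * ∑ i ∈ Finset.range l, y ^ i := by
        simp only [hpow, Finset.mul_sum, ← pow_succ']
    _ = y * (y ^ l - 1) / (y - 1) := by rw [geom_sum_eq hy.ne', mul_div_assoc]
    _ ≤ y * (y * (n : ℝ) ^ δ) / (y - 1) := by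
        gcongr
        linarith
    _ = y * y / (y - 1) * (n : ℝ) ^ δ := by ring

lemma one_sub_two_div_add_le {ω ε : ℝ} (hω : 2 ≤ ω) (hε : 0 ≤ ε) :
    1 - 2 / (ω + ε) ≤ 1 - 2 / ω + ε := by
  have hdiff : 2 / ω - 2 / (ω + ε) = 2 * ε / (ω * (ω + ε)) := by
    have : ω ≠ 0 := by linarith
    have : ω + ε ≠ 0 := by linarith
    field_simp
    ring
  have hle : 2 * ε / (ω * (ω + ε)) ≤ ε := by
    rw [div_le_iff₀ (by nlinarith)]
    nlinarith [mul_nonneg hε (by linarith : 0 ≤ ω - 2), mul_nonneg hε hε]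
  linarith

end Parameters

section Coding

lemma exists_eval_le_add_one_pow (p : Polynomial ℕ) :
    ∃ c : ℕ, ∀ n : ℕ, 1 ≤ n → p.eval n ≤ (n + 1) ^ c := by
  refine ⟨p.eval 1 + p.natDegree, fun n hn => ?_⟩
  calc p.eval n ≤ p.eval 1 * n ^ p.natDegree := by
        simp only [Polynomial.eval_eq_sum_range, one_pow, mul_one, Finset.sum_mul]
        gcongr with i hi
        exact Nat.lt_succ_iff.1 (Finset.mem_range.1 hi)
    _ ≤ (n + 1) ^ p.eval 1 * (n + 1) ^ p.natDegree := by
        gcongr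
        · exact (Nat.lt_pow_self (by omega)).le
        · omega
    _ = (n + 1) ^ (p.eval 1 + p.natDegree) := (pow_add _ _ _).symm

lemma add_one_le_two_pow_messageBits {β : ℕ} (hβ : 1 ≤ β) (n : ℕ) :
    n + 1 ≤ 2 ^ messageBits β n :=
  (Nat.le_pow_clog one_lt_two (n + 1)).trans
    (Nat.pow_le_pow_right two_pos (Nat.le_mul_of_pos_left _ hβ))

lemma exists_injective_code {F : ℕ → Type*} [∀ n, Finite (F n)]
    (hF : ∃ p : Polynomial ℕ, ∀ n : ℕ, 1 ≤ n → Nat.card (F n) ≤ p.eval n) {β : ℕ} (hβ : 1 ≤ β) :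
    ∃ c : ℕ, ∀ n : ℕ, 1 ≤ n →
      ∃ code : F n → Fin c → Fin (messageBits β n) → Bool, Function.Injective code := by
  obtain ⟨p, hp⟩ := hF
  obtain ⟨c, hc⟩ := exists_eval_le_add_one_pow p
  refine ⟨c, fun n hn => ?_⟩
  have := Fintype.ofFinite (F n)
  have hcard : Fintype.card (F n) ≤ Fintype.card (Fin c → Fin (messageBits β n) → Bool) := by
    calc Fintype.card (F n) ≤ (n + 1) ^ c :=
          Nat.card_eq_fintype_card (α := F n) ▸ (hp n hn).trans (hc n hn)
      _ ≤ (2 ^ messageBits β n) ^ c :=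
          Nat.pow_le_pow_left (add_one_le_two_pow_messageBits hβ n) c
      _ = Fintype.card (Fin c → Fin (messageBits β n) → Bool) := by simp
  obtain ⟨code⟩ := Function.Embedding.nonempty_of_card_le hcard
  exact ⟨code, code.injective⟩

end Coding

section Inversion

variable {n P d e t κ b c : ℕ} {F : Type*} [Field F] {Ω : Type*} {K : Knowledge n Ω}
  {A : Ω → Matrix (Fin n) (Fin n) F}

theorem BlockLayout.exists_reach_blockDiagonalPart_inv (L : BlockLayout n P d e t κ)
    {code : F → Fin c → Fin b → Bool} (hcode : Function.Injective code)
    (halg : HasAlgebraicMMAlgorithm F d d t) {block : Fin n → ℕ}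
    (hL : ∀ i, ((L.pos i).1 : ℕ) = block i / 2)
    (hA : ∀ ω, (A ω).BlockTriangular (toDual ∘ block)) (hu : ∀ ω, IsUnit (A ω))
    (hKA : K.KnowsShares A) (hK : K.KnowsShares fun ω => blockDiagonalPart block (A ω)⁻¹) :
    ∃ K', Knowledge.Reach b (2 * (7 * (4 * κ * c))) K K' ∧
      K'.KnowsShares fun ω => blockDiagonalPart ((· / 2) ∘ block) (A ω)⁻¹ := by
  have hdiag {M : Matrix (Fin n) (Fin n) F} (hM : IsBlockDiagonal ((· / 2) ∘ block) M) :
      IsBlockDiagonal (fun i => (L.pos i).1) M :=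
    fun i j hij => hM i j (by simpa only [Function.comp_apply, ← hL, ne_eq, Fin.val_inj])
  have hB (ω : Ω) := hdiag ((isBlockDiagonal_blockDiagonalPart block (A ω)⁻¹).comp _)
  have hE (ω : Ω) := hdiag (isBlockDiagonal_pairOffDiagonalPart block (A ω))
  have hKE : K.KnowsShares fun ω => pairOffDiagonalPart block (A ω) :=
    (hKA.blockDiagonalPart _).sub (hKA.blockDiagonalPart _)
  obtain ⟨K₁, hK₁, h₁⟩ := L.exists_reach_knowsShares_mul hcode halg hB hE hK hKE
  obtain ⟨K₂, hK₂, h₂⟩ := L.exists_reach_knowsShares_mul hcode halg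
    (fun ω => (hB ω).mul (hE ω)) hB h₁ (hK.mono hK₁.le)
  refine ⟨K₂, two_mul (7 * (4 * κ * c)) ▸ hK₁.trans hK₂, ?_⟩
  simp only [blockDiagonalPart_div_two_inv (hA _) (hu _)]
  exact (hK.mono (hK₂.le.trans hK₁.le)).sub h₂

lemma Knowledge.knowsShares_blockDiagonalPart_inv_of_injective {α : Type*} [LinearOrder α]
    {block : Fin n → α} (hblock : Function.Injective block)
    (hA : ∀ ω, (A ω).BlockTriangular (toDual ∘ block)) (hu : ∀ ω, IsUnit (A ω))
    (hKA : K.KnowsShares A) : K.KnowsShares fun ω => blockDiagonalPart block (A ω)⁻¹ := by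
  intro i j
  by_cases hij : i = j
  · subst hij
    have hinv (ω : Ω) : blockDiagonalPart block (A ω)⁻¹ i i = (A ω i i)⁻¹ := by
      rw [blockDiagonalPart_of_injective hblock, Matrix.diagonal_apply_eq]
      exact eq_inv_of_mul_eq_one_right (apply_mul_inv_apply_self hblock (hA ω) (hu ω) i)
    simp only [hinv]
    exact ⟨(hKA i i).1.comp _, (hKA i i).2.comp _⟩
  · simp only [blockDiagonalPart_of_injective hblock, Matrix.diagonal_apply_ne _ hij]
    exact ⟨K.knows_const _ _, K.knows_const _ _⟩

lemma blockTriangular_div_of_mem_lowerTriangularMatrices {M : Matrix (Fin n) (Fin n) F}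
    (hM : M ∈ lowerTriangularMatrices F n) (m : ℕ) :
    M.BlockTriangular (toDual ∘ fun i => (i : ℕ) / m) :=
  fun _ _ hij => hM _ _ (Nat.lt_of_div_lt_div (toDual_lt_toDual.1 hij))

theorem exists_reach_blockDiagonalPart_inv_two_pow {code : F → Fin c → Fin b → Bool}
    (hcode : Function.Injective code) {cost : ℕ → ℝ}
    (hlayout : ∀ k, 2 ^ k < n → HasBlockLayout F n (2 ^ (k + 1)) (cost k))
    (hA : ∀ ω, A ω ∈ lowerTriangularMatrices F n) (hu : ∀ ω, IsUnit (A ω))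
    (hKA : K.KnowsShares A) {k : ℕ} (hk : k ≤ Nat.clog 2 n) :
    ∃ (r : ℕ) (K' : Knowledge n Ω), r ≤ 56 * c * ∑ i ∈ Finset.range k, cost i ∧
      Knowledge.Reach b r K K' ∧
        K'.KnowsShares fun ω => blockDiagonalPart (fun i => (i : ℕ) / 2 ^ k) (A ω)⁻¹ := by
  have htri (ω : Ω) := blockTriangular_div_of_mem_lowerTriangularMatrices (hA ω)
  induction k with
  | zero =>
    refine ⟨0, K, by simp, .refl K, ?_⟩
    refine Knowledge.knowsShares_blockDiagonalPart_inv_of_injective ?_ (htri · _) hu hKA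
    simpa only [pow_zero, Nat.div_one] using Fin.val_injective
  | succ k ih =>
    obtain ⟨r, K₁, hr, hreach₁, hK₁⟩ := ih (Nat.le_of_succ_le hk)
    obtain ⟨P, d, e, t, κ, halg, hκ, L, hL⟩ := hlayout k (Nat.pow_lt_of_lt_clog hk)
    have hdiv (i : Fin n) : (i : ℕ) / 2 ^ (k + 1) = i / 2 ^ k / 2 := by
      rw [Nat.div_div_eq_div_mul, pow_succ]
    simp only [hdiv] at hL ⊢
    obtain ⟨K₂, hreach₂, hK₂⟩ := L.exists_reach_blockDiagonalPart_inv hcode halg hL (htri · _) hu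
      (hKA.mono hreach₁.le) hK₁
    refine ⟨_, K₂, ?_, hreach₁.trans hreach₂, hK₂⟩
    rw [Finset.sum_range_succ, mul_add]
    push_cast
    nlinarith [mul_le_mul_of_nonneg_left hκ c.cast_nonneg]

theorem exists_reach_inv {code : F → Fin c → Fin b → Bool} (hcode : Function.Injective code)
    {cost : ℕ → ℝ}
    (hlayout : ∀ k, 2 ^ k < n → HasBlockLayout F n (2 ^ (k + 1)) (cost k))
    (hA : ∀ ω, A ω ∈ lowerTriangularMatrices F n) (hu : ∀ ω, IsUnit (A ω))
    (hKA : K.KnowsShares A) :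
    ∃ (r : ℕ) (K' : Knowledge n Ω), r ≤ 56 * c * ∑ i ∈ Finset.range (Nat.clog 2 n), cost i ∧
      Knowledge.Reach b r K K' ∧ K'.KnowsShares fun ω => (A ω)⁻¹ := by
  obtain ⟨r, K', hr, hreach, hK'⟩ :=
    exists_reach_blockDiagonalPart_inv_two_pow hcode hlayout hA hu hKA le_rfl
  have hblock (i : Fin n) : (i : ℕ) / 2 ^ Nat.clog 2 n = 0 :=
    Nat.div_eq_of_lt (i.2.trans_le (Nat.le_pow_clog one_lt_two n))
  simp only [blockDiagonalPart_of_forall_eq fun i j => (hblock i).trans (hblock j).symm] at hK'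
  exact ⟨r, K', hr, hreach, hK'⟩

theorem exists_inversionSolvableInRounds {β : ℕ} {code : F → Fin c → Fin (messageBits β n) → Bool}
    (hcode : Function.Injective code) {cost : ℕ → ℝ}
    (hlayout : ∀ k, 2 ^ k < n → HasBlockLayout F n (2 ^ (k + 1)) (cost k)) :
    ∃ r : ℕ, r ≤ 56 * c * ∑ i ∈ Finset.range (Nat.clog 2 n), cost i ∧
      InversionSolvableInRounds β n (lowerTriangularMatrices F n) r := by
  let Ω := {A : Matrix (Fin n) (Fin n) F // A ∈ lowerTriangularMatrices F n ∧ IsUnit A}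
  obtain ⟨r, K, hr, hreach, hK⟩ := exists_reach_inv hcode hlayout (A := fun ω : Ω => ω.1)
    (K := Knowledge.initial fun ω => nodeShare ω.1) (fun ω => ω.2.1) (fun ω => ω.2.2)
    (Knowledge.knowsShares_iff.2 fun _ _ _ h => h)
  have : Inhabited F := ⟨0⟩
  obtain ⟨Q, hQ⟩ := hreach.exists_protocol (output := fun ω => nodeShare ω.1⁻¹)
    (Knowledge.knowsShares_iff.1 hK)
  exact ⟨r, hr, Q, fun A hA hu => hQ ⟨A, hA, hu⟩⟩

end Inversion

section Complexity

variable {F : ℕ → Type*} [∀ n, Field (F n)] {β : ℕ} {ρ σ τ : ℝ}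

/-- Invertible lower triangular matrices over the fields of the family `F` can be inverted in
`O(n ^ ρ)` rounds of the congested clique with `n` nodes. The constant does not depend on the member
of the family. -/
def TriangularInversionRoundsBigO (F : ℕ → Type*) [∀ n, Field (F n)] (β : ℕ) (ρ : ℝ) : Prop :=
  ∃ C : ℝ, ∀ n : ℕ, 1 ≤ n → ∃ r : ℕ, (r : ℝ) ≤ C * (n : ℝ) ^ ρ ∧
    InversionSolvableInRounds β n (lowerTriangularMatrices (F n) n) r

lemma TriangularInversionRoundsBigO.mono (h : TriangularInversionRoundsBigO F β ρ) (hρσ : ρ ≤ σ) :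
    TriangularInversionRoundsBigO F β σ := by
  obtain ⟨C, hC⟩ := h
  refine ⟨|C|, fun n hn => ?_⟩
  obtain ⟨r, hr, hsolvable⟩ := hC n hn
  refine ⟨r, hr.trans ?_, hsolvable⟩
  gcongr
  · exact le_abs_self C
  · exact_mod_cast hn

theorem SquareMMRankBigO.triangularInversionRoundsBigO [∀ n, Finite (F n)]
    (h : SquareMMRankBigO F τ) (hτ : 2 < τ)
    (hF : ∃ p : Polynomial ℕ, ∀ n : ℕ, 1 ≤ n → Nat.card (F n) ≤ p.eval n) (hβ : 1 ≤ β) :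
    TriangularInversionRoundsBigO F β (1 - 2 / τ) := by
  obtain ⟨c, hcode⟩ := exists_injective_code hF hβ
  obtain ⟨C₁, hC₁, hlayout⟩ := h.exists_hasBlockLayout
  obtain ⟨C₂, hsum⟩ := exists_sum_range_clog_rpow_le
    (sub_pos.2 ((div_lt_one (by linarith)).2 hτ) : 0 < 1 - 2 / τ)
  refine ⟨56 * c * (C₁ * C₂), fun n hn => ?_⟩
  obtain ⟨code, hcode⟩ := hcode n hn
  obtain ⟨r, hr, hsolvable⟩ := exists_inversionSolvableInRounds hcode fun k hk =>
    hlayout n (2 ^ (k + 1)) hn Nat.one_le_two_pow (by omega)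
  refine ⟨r, hr.trans ?_, hsolvable⟩
  rw [← Finset.mul_sum, mul_assoc _ (C₁ * C₂), mul_assoc C₁]
  gcongr
  exact hsum n hn

end Complexity

theorem mainTheorem10 (F : ℕ → Type*) [∀ n, Field (F n)] [∀ n, Finite (F n)]
    (hF : ∃ p : Polynomial ℕ, ∀ n : ℕ, 1 ≤ n → Nat.card (F n) ≤ p.eval n)
    (β : ℕ) (hβ : 1 ≤ β) :
    (∀ ε : ℝ, 0 < ε → ∃ C : ℝ, ∀ n : ℕ, 1 ≤ n → ∃ r : ℕ,
      (r : ℝ) ≤ C * (n : ℝ) ^ (1 - 2 / matMulExponent F + ε) ∧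
        InversionSolvableInRounds β n (lowerTriangularMatrices (F n) n) r) ∧
    (∀ τ : ℝ, 2 < τ → SquareMMRankBigO F τ → ∃ C : ℝ, ∀ n : ℕ, 1 ≤ n → ∃ r : ℕ,
      (r : ℝ) ≤ C * (n : ℝ) ^ (1 - 2 / τ) ∧
        InversionSolvableInRounds β n (lowerTriangularMatrices (F n) n) r) := by
  refine ⟨fun ε hε => ?_, fun τ hτ h => h.triangularInversionRoundsBigO hτ hF hβ⟩
  have hω : 2 ≤ matMulExponent F := two_le_matMulExponent F
  have hrank : SquareMMRankBigO F (matMulExponent F + ε) :=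
    squareMMRankBigO_of_matMulExponent_lt (lt_add_of_pos_right _ hε)
  exact (hrank.triangularInversionRoundsBigO (by linarith) hF hβ).mono
    (one_sub_two_div_add_le hω hε.le)
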